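/- Let $n,t$ be integers with $0<t<n$, let $\Pi=\{P_1,\dots,P_n\}$ be a set of $n$ processes, and let $\mathcal V_I$ (proposals) and $\mathcal V_O$ (decisions) be effectively encoded, possibly infinite, sets of values. An \emph{input configuration} is an assignment $c$ of proposals in $\mathcal V_I$ to the processes of a set $\pi(c)\subseteq\Pi$ with $n-t\le|\pi(c)|\le n$; $\mathcal I$ is the set of all input configurations, and $\mathcal I_{n-t}$ the set of those with $|\pi(c)|=n-t$. Two configurations are \emph{similar}, $c\sim c'$, if $\pi(c)\cap\pi(c')\ne\emptyset$ and $c[i]=c'[i]$ for every $P_i\in\pi(c)\cap\pi(c')$. A \emph{validity property} is a function $\mathit{val}:\mathcal I\to 2^{\mathcal V_O}$ with $\mathit{val}(c)\neq\emptyset$ for all $c$. \emph{Model.} An algorithm gives every process a deterministic, computable state machine, which takes a step when the process starts (and proposes its value), when it receives a message, and when its local clock ticks; in a step it changes its state, sends messages, and possibly decides a value of $\mathcal V_O$. In an execution at most $t$ processes are faulty, and these behave arbitrarily; the others are correct and follow the algorithm. Only finitely many steps are taken in finite time. The channels are authenticated and point-to-point. There is a time GST, unknown to the processes, such that a message sent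 by a correct process to a correct process at time $s$ is received by time $\max(s,\mathrm{GST})+\delta$, where $\delta>0$ is known; correct processes start by GST; local clocks of correct processes may drift arbitrarily before GST and do not drift after it. An execution corresponds to $c\in\mathcal I$ if $\pi(c)$ is its set of correct processes and each $P_i\in\pi(c)$ proposes the value $c$ assigns to it. The property $\mathit{val}$ is \emph{solvable} if there is an algorithm such that in each of its infinite executions every correct process decides, exactly once; no two correct processes decide different values; and, if the execution corresponds to $c$, correct processes decide only values in $\mathit{val}(c)$. \textbf{Theorem.} For all $n$, $t$ with $0<t<n$ and every $\delta>0$, every solvable validity property $\mathit{val}$ satisfies the similarity condition $\mathcal C_S$: there is a Turing-computable function $\Lambda:\mathcal I_{n-t}\to\mathcal V_O$ such that $$\forall c\in\mathcal I_{n-t}:\quad \Lambda(c)\in\bigcap_{c'\in\mathcal I,\ c'\sim c}\mathit{val}(c').$$ -/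

import Mathlib

/-! ### Input configurations and validity properties -/

/-- The processes `P_i` to which the partial assignment `c` gives a proposal, i.e. `c[i] ≠ ⊥`. -/
def procs {n : ℕ} {VI : Type*} (c : Fin n → Option VI) : Finset (Fin n) :=
  Finset.univ.filter fun i => (c i).isSome = true

/-- Input configurations: assignments of proposals to at least `n - t` (and at most `n`) of the
`n` processes. -/
def InputConfig (n t : ℕ) (VI : Type*) : Type _ :=
  {c : Fin n → Option VI // n - t ≤ (procs c).card}

/-- Input configurations with exactly `x` process-proposal pairs. -/
def InputConfigOfSize (n t : ℕ) (VI : Type*) (x : ℕ) : Type _ :=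
  {c : InputConfig n t VI // (procs c.1).card = x}

theorem primrec_card_procs (n : ℕ) (VI : Type*) [Primcodable VI] :
    Primrec fun c : Fin n → Option VI => (procs c).card := by
  have h1 : Primrec fun c : Fin n → Option VI => List.ofFn fun i => c i :=
    Primrec.list_ofFn fun i => Primrec.fin_app.comp Primrec.id (Primrec.const i)
  have h2 : Primrec fun c : Fin n → Option VI =>
      (((List.ofFn fun i => c i).filterMap id)).length :=
    Primrec.list_length.comp (Primrec.listFilterMap h1 Primrec.snd.to₂)
  refine h2.of_eq fun c => ?_
  have h3 : ∀ l : List (Option VI),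
      (l.filterMap id).length = l.countP fun o => o.isSome := by
    intro l
    induction l with
    | nil => rfl
    | cons a l ih => cases a <;> simpa using ih
  rw [h3]
  unfold procs
  rw [List.ofFn_eq_map, List.countP_map, List.countP_eq_length_filter,
    ← List.toFinset_card_of_nodup ((List.nodup_finRange n).filter _)]
  congr 1
  ext i
  simp

instance instPrimcodableInputConfig (n t : ℕ) (VI : Type*) [Primcodable VI] :
    Primcodable (InputConfig n t VI) :=
  Primcodable.subtype (Primrec.nat_le.comp (Primrec.const (n - t)) (primrec_card_procs n VI))

theorem primrec_inputConfig_val (n t : ℕ) (VI : Type*) [Primcodable VI] :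
    Primrec fun c : InputConfig n t VI => c.1 :=
  Primrec.subtype_val
    (hp := Primrec.nat_le.comp (Primrec.const (n - t)) (primrec_card_procs n VI))

instance instPrimcodableInputConfigOfSize (n t : ℕ) (VI : Type*) [Primcodable VI] (x : ℕ) :
    Primcodable (InputConfigOfSize n t VI x) :=
  Primcodable.subtype (Primrec.eq.comp
    ((primrec_card_procs n VI).comp (primrec_inputConfig_val n t VI)) (Primrec.const x))

/-- `c₁ ∼ c₂`: the configurations share a process, and agree on every common process. -/
def SimilarConfig {n t : ℕ} {VI : Type*} (c₁ c₂ : InputConfig n t VI) : Prop :=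
  (procs c₁.1 ∩ procs c₂.1).Nonempty ∧ ∀ i ∈ procs c₁.1 ∩ procs c₂.1, c₁.1 i = c₂.1 i

/-- Validity properties: every input configuration has a nonempty set of admissible decisions. -/
structure ValidityProperty (n t : ℕ) (VI VO : Type*) where
  /-- The admissible decisions. -/
  adm : InputConfig n t VI → Set VO
  adm_nonempty : ∀ c, (adm c).Nonempty

/-- The similarity condition: some Turing-computable function on the configurations of exactly
`n - t` processes returns a value admissible for all similar configurations. -/
def SimilarityCondition {n t : ℕ} {VI VO : Type*} [Primcodable VI] [Primcodable VO]
    (val : ValidityProperty n t VI VO) : Prop :=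
  ∃ Λ : InputConfigOfSize n t VI (n - t) → VO, Computable Λ ∧
    ∀ (c : InputConfigOfSize n t VI (n - t)) (c' : InputConfig n t VI),
      SimilarConfig c' c.1 → Λ c ∈ val.adm c'

/-! ### Algorithms -/

/-- The result of a computational step: the new local state, the list of messages sent
(destination and content), and the decision made in this step, if any. Local states and message
contents are finite words, coded by natural numbers. -/
abbrev StepResult (n : ℕ) (VO : Type*) : Type _ := ℕ × List (Fin n × ℕ) × Option VO

/-- A distributed algorithm: for each of the `n` processes a deterministic, computable state
machine. A process takes a step when it starts (and proposes), when it receives a message, and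
when its local clock ticks. -/
structure Algorithm (n : ℕ) (VI VO : Type*) [Primcodable VI] [Primcodable VO] where
  /-- `start i v`: process `i` starts and proposes `v`. -/
  start : Fin n → VI → StepResult n VO
  /-- `receive i s j m`: process `i`, in state `s`, receives `m` from process `j`. -/
  receive : Fin n → ℕ → Fin n → ℕ → StepResult n VO
  /-- `tick i s`: the local clock of process `i`, in state `s`, ticks. -/
  tick : Fin n → ℕ → StepResult n VO
  start_computable : Computable fun x : Fin n × VI => start x.1 x.2
  receive_computable : Computable fun x : Fin n × ℕ × Fin n × ℕ =>
    receive x.1 x.2.1 x.2.2.1 x.2.2.2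
  tick_computable : Computable fun x : Fin n × ℕ => tick x.1 x.2

/-! ### Executions in the partially synchronous model -/

/-- What triggers a step of a correct process. `receive k p` is the receipt of the message at
position `p` in the list of messages sent in the `k`-th step of the execution. -/
inductive Trigger (VI : Type*) where
  | start (v : VI)
  | receive (k p : ℕ)
  | tick

/-- The infinite executions of `A` with at most `t` faulty processes, in which messages between
correct processes take at most `δ` after GST. All the steps of all processes are listed in the
order in which they occur. The unit of time is the tick of a local clock that does not drift. -/
structure Execution {n : ℕ} {VI VO : Type*} [Primcodable VI] [Primcodable VO]
    (A : Algorithm n VI VO) (t : ℕ) (δ : ℝ) where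
  /-- The correct processes. -/
  corr : Finset (Fin n)
  /-- The global stabilization time. -/
  GST : ℝ
  /-- The time of the `k`-th step. -/
  time : ℕ → ℝ
  /-- The process that takes the `k`-th step. -/
  actor : ℕ → Fin n
  /-- What triggers the `k`-th step (irrelevant for steps of faulty processes). -/
  trigger : ℕ → Trigger VI
  /-- The messages (destination and content) sent in the `k`-th step. -/
  sent : ℕ → List (Fin n × ℕ)
  /-- The decision made in the `k`-th step, if any. -/
  decision : ℕ → Option VO
  /-- The local state of each process just before the `k`-th step; `none` before its start. -/
  state : ℕ → Fin n → Option ℕ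
  corr_card : n - t ≤ corr.card
  GST_nonneg : 0 ≤ GST
  time_nonneg : ∀ k, 0 ≤ time k
  time_mono : Monotone time
  /-- Only finitely many steps are taken in finite time. -/
  time_tendsto : Filter.Tendsto time Filter.atTop Filter.atTop
  state_zero : ∀ i ∈ corr, state 0 i = none
  state_of_ne : ∀ k, ∀ i ∈ corr, i ≠ actor k → state (k + 1) i = state k i
  /-- Correct processes follow the algorithm. The channels are authenticated: the recipient
  learns the true sender, and every received message was sent before. Nothing is required of the
  steps of faulty processes, which can send arbitrary messages. -/
  step : ∀ k, actor k ∈ corr → ∃ r : StepResult n VO,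
    (match trigger k with
      | .start v => state k (actor k) = none ∧ r = A.start (actor k) v
      | .receive k' p => ∃ s m, state k (actor k) = some s ∧ k' < k ∧
          (sent k')[p]? = some (actor k, m) ∧ r = A.receive (actor k) s (actor k') m
      | .tick => ∃ s, state k (actor k) = some s ∧ r = A.tick (actor k) s) ∧
    state (k + 1) (actor k) = some r.1 ∧ sent k = r.2.1 ∧ decision k = r.2.2
  /-- No message is received twice. -/
  receive_once : ∀ k₁ k₂ k p, actor k₁ ∈ corr → actor k₂ ∈ corr →
    trigger k₁ = .receive k p → trigger k₂ = .receive k p → k₁ = k₂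
  /-- Messages between correct processes are received, with delay at most `δ` after GST. -/
  delivery : ∀ k p j m, actor k ∈ corr → j ∈ corr → (sent k)[p]? = some (j, m) →
    ∃ k', actor k' = j ∧ trigger k' = .receive k p ∧ time k' ≤ max (time k) GST + δ
  /-- Correct processes start before or at GST. -/
  start_le : ∀ i ∈ corr, ∃ k v, actor k = i ∧ trigger k = .start v ∧ time k ≤ GST
  /-- The local clock of a correct process does not drift after GST: the ticks after GST are
  exactly one time unit apart. Before GST, it may tick at any times. -/
  clock : ∀ i ∈ corr, ∃ θ : ℝ, GST < θ ∧ θ ≤ GST + 1 ∧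
    (∀ k, actor k = i → trigger k = .tick → GST < time k → ∃ m : ℕ, time k = θ + m) ∧
    ∀ m : ℕ, ∃! k, actor k = i ∧ trigger k = .tick ∧ time k = θ + m

namespace Execution

variable {n : ℕ} {VI VO : Type*} [Primcodable VI] [Primcodable VO]
  {A : Algorithm n VI VO} {t : ℕ} {δ : ℝ}

/-- The correct process `i` proposes `v`. -/
def Proposes (E : Execution A t δ) (i : Fin n) (v : VI) : Prop :=
  i ∈ E.corr ∧ ∃ k, E.actor k = i ∧ E.trigger k = .start v

/-- The correct process `i` decides `v` in the `k`-th step. -/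
def DecidesAt (E : Execution A t δ) (i : Fin n) (v : VO) (k : ℕ) : Prop :=
  i ∈ E.corr ∧ E.actor k = i ∧ E.decision k = some v

/-- The execution corresponds to the input configuration `c`. -/
def Corresponds (E : Execution A t δ) (c : InputConfig n t VI) : Prop :=
  procs c.1 = E.corr ∧ ∀ i v, c.1 i = some v → E.Proposes i v

end Execution

/-- `A` solves consensus with `val`. -/
structure Solves {n : ℕ} {VI VO : Type*} [Primcodable VI] [Primcodable VO]
    (A : Algorithm n VI VO) {t : ℕ} (δ : ℝ) (val : ValidityProperty n t VI VO) : Prop where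
  termination : ∀ E : Execution A t δ, ∀ i ∈ E.corr, ∃ v k, E.DecidesAt i v k
  agreement : ∀ (E : Execution A t δ) i j v w k l,
    E.DecidesAt i v k → E.DecidesAt j w l → v = w
  decides_once : ∀ (E : Execution A t δ) i v w k l,
    E.DecidesAt i v k → E.DecidesAt i w l → k = l
  validity : ∀ (E : Execution A t δ) (c : InputConfig n t VI), E.Corresponds c →
    ∀ i v k, E.DecidesAt i v k → v ∈ val.adm c

/-- `val` is solvable, when the bound `δ` on message delays after GST is known. -/
def Solvable {n t : ℕ} {VI VO : Type*} [Primcodable VI] [Primcodable VO]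
    (δ : ℝ) (val : ValidityProperty n t VI VO) : Prop :=
  ∃ A : Algorithm n VI VO, Solves A δ val

/-! Let `A` solve `val`, and let `c` be a configuration. If exactly the processes of `c` are correct
and all others stay silent, termination and agreement yield a finite run after which every process
of `c` has decided one common value `v` (`exists_allDecide`).

This `v` is admissible for every `c'` similar to `c`. Take the finite run as the beginning of an
execution whose correct processes are those of `c'`. The processes of `c` outside `c'` are now
faulty, although they follow the algorithm during the run; the processes of `c'` outside `c` are
correct but slow, and start only after the run. All of this happens before GST, so no timing
guarantee is violated, and after the run everything proceeds fairly (`exists_execution_of_validLog`,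
built on `exists_fair_extension`). A process common to `c` and `c'` is correct and has decided `v`,
so validity for `c'` gives `v ∈ val.adm c'` (`mem_adm_of_allDecide`). Since the common process
depends on `c'`, all processes of `c` are required to decide.

Finite runs are lists of events that can be simulated, because the state machines are computable.
Hence `Λ c` is found by searching all pairs of an event list and a value until the value is decided
by all of `c` (`exists_computable_decision`). The search halts because a suitable run exists, and
any run it finds will do. No computability of `val` enters. -/

/-! ### Finite runs without steps of faulty processes -/

/-- The event that a process starts (`none`), that its clock ticks (`some none`), or that it
receives the message at position `p` of those sent in the `k`-th step (`some (some (k, p))`). -/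
abbrev Event (n : ℕ) : Type := Fin n × Option (Option (ℕ × ℕ))

/-- A finite sequence of events, each with the computational step that it triggered. -/
abbrev Log (n : ℕ) (VO : Type*) : Type _ := List (Event n × StepResult n VO)

section Run

variable {n : ℕ} {VI VO : Type*}

/-- The state of process `i` after `L`. -/
def stateOf (L : Log n VO) (i : Fin n) : Option ℕ :=
  L.foldl (fun s x => if x.1.1 = i then some x.2.1 else s) none

@[simp] theorem stateOf_nil (i : Fin n) : stateOf ([] : Log n VO) i = none := rfl

@[simp] theorem stateOf_concat (L : Log n VO) (x : Event n × StepResult n VO) (i : Fin n) :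
    stateOf (L ++ [x]) i = if x.1.1 = i then some x.2.1 else stateOf L i := by
  simp [stateOf]

theorem stateOf_append_isSome {L : Log n VO} {i : Fin n} (h : (stateOf L i).isSome)
    (L' : Log n VO) : (stateOf (L ++ L') i).isSome := by
  induction L' using List.reverseRecOn with
  | nil => simpa using h
  | append_singleton l x ih =>
    rw [← List.append_assoc, stateOf_concat]
    split <;> simp [ih]

theorem stateOf_isSome_of_mem {L : Log n VO} {x : Event n × StepResult n VO} (h : x ∈ L) :
    (stateOf L x.1.1).isSome := by
  induction L using List.reverseRecOn with
  | nil => simp at h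
  | append_singleton l y ih =>
    rw [stateOf_concat]
    split
    · simp
    · rcases List.mem_append.1 h with h | h
      · exact ih h
      · simp_all

variable [Primcodable VI] [Primcodable VO]

/-- The step in which process `i` receives the message at position `q.2` of those sent in step
`q.1` of `L`; it is `none` if this is impossible. -/
def receiveResult (A : Algorithm n VI VO) (L : Log n VO) (i : Fin n) (q : ℕ × ℕ) :
    Option (StepResult n VO) :=
  if ∃ x ∈ L, x.1 = (i, some (some q)) then none else
    (stateOf L i).bind fun s => L[q.1]?.bind fun x => x.2.2.1[q.2]?.bind fun y =>
      if y.1 = i then some (A.receive i s x.1.1 y.2) else none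

/-- The step triggered by the event `e` after `L`, when the proposals are given by `c`; it is
`none` if the event is impossible. -/
def stepResult (A : Algorithm n VI VO) (c : Fin n → Option VI) (L : Log n VO) (e : Event n) :
    Option (StepResult n VO) :=
  match e.2 with
  | none => if stateOf L e.1 = none then (c e.1).map (A.start e.1) else none
  | some none => (stateOf L e.1).map (A.tick e.1)
  | some (some q) => receiveResult A L e.1 q

/-- The log after `L` and the event `e`, where an impossible event has no effect. -/
def extendLog (A : Algorithm n VI VO) (c : Fin n → Option VI) (L : Log n VO) (e : Event n) :
    Log n VO :=
  (stepResult A c L e).elim L fun r => L ++ [(e, r)]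

/-- The log after `L` and the events `es`, where impossible events have no effect. -/
def run (A : Algorithm n VI VO) (c : Fin n → Option VI) (L : Log n VO) (es : List (Event n)) :
    Log n VO :=
  es.foldl (extendLog A c) L

/-- Every step of the log is possible after the preceding ones. -/
def ValidLog (A : Algorithm n VI VO) (c : Fin n → Option VI) (L : Log n VO) : Prop :=
  ∀ k x, L[k]? = some x → stepResult A c (L.take k) x.1 = some x.2

variable {A : Algorithm n VI VO} {c : Fin n → Option VI}

theorem run_append (L : Log n VO) (es es' : List (Event n)) :
    run A c L (es ++ es') = run A c (run A c L es) es' :=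
  List.foldl_append

/-- Impossible events are dropped and the others keep their order. The sublist relation later
carries membership and absence of repetitions from the events tried to the steps taken. -/
theorem run_eq_append (L : Log n VO) (es : List (Event n)) :
    ∃ new, run A c L es = L ++ new ∧ (new.map Prod.fst).Sublist es := by
  induction es generalizing L with
  | nil => exact ⟨[], by simp [run]⟩
  | cons e es ih =>
    obtain ⟨new, h1, h2⟩ := ih (extendLog A c L e)
    change run A c L (e :: es) = _ at h1
    cases h : stepResult A c L e with
    | none =>
      refine ⟨new, ?_, h2.cons e⟩
      simpa [extendLog, h] using h1
    | some r =>
      refine ⟨(e, r) :: new, ?_, by simpa using h2⟩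
      simpa [extendLog, h] using h1

/-- Every event of `es` is tried at some point of the run. -/
theorem run_tries (L : Log n VO) {es : List (Event n)} {e : Event n} (he : e ∈ es) :
    ∃ a b, run A c L es = L ++ a ++ b ∧
      (stepResult A c (L ++ a) e = none ∨ ∃ r b', b = (e, r) :: b') := by
  obtain ⟨es₁, es₂, rfl⟩ := List.append_of_mem he
  obtain ⟨a, ha, -⟩ := run_eq_append (A := A) (c := c) L es₁
  have h : run A c L (es₁ ++ e :: es₂) = run A c (extendLog A c (L ++ a) e) es₂ := by
    rw [run_append, ha]; rfl
  obtain ⟨b, hb, -⟩ := run_eq_append (A := A) (c := c) (extendLog A c (L ++ a) e) es₂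
  cases hs : stepResult A c (L ++ a) e with
  | none => exact ⟨a, b, by simpa [extendLog, hs, h] using hb, .inl hs⟩
  | some r => exact ⟨a, (e, r) :: b, by simpa [extendLog, hs, h] using hb, .inr ⟨r, b, rfl⟩⟩

theorem validLog_nil : ValidLog A c [] := by simp [ValidLog]

theorem ValidLog.extendLog {L : Log n VO} (h : ValidLog A c L) (e : Event n) :
    ValidLog A c (extendLog A c L e) := by
  cases hs : stepResult A c L e with
  | none => simpa [_root_.extendLog, hs] using h
  | some r =>
    simp only [_root_.extendLog, hs, Option.elim]
    intro k x hk
    rcases lt_trichotomy k L.length with hlt | heq | hgt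
    · rw [List.getElem?_append_left hlt] at hk
      rw [List.take_append_of_le_length hlt.le]
      exact h k x hk
    · subst heq
      simp only [List.getElem?_concat_length, Option.some.injEq] at hk
      subst hk
      simpa using hs
    · rw [List.getElem?_eq_none (by simp; omega)] at hk
      cases hk

theorem ValidLog.run {L : Log n VO} (h : ValidLog A c L) (es : List (Event n)) :
    ValidLog A c (run A c L es) := by
  induction es generalizing L with
  | nil => exact h
  | cons e es ih => exact ih (h.extendLog e)

theorem ValidLog.take {L : Log n VO} (h : ValidLog A c L) (m : ℕ) :
    ValidLog A c (L.take m) := by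
  intro k x hk
  rw [List.getElem?_take] at hk
  split at hk
  · rw [List.take_take, min_eq_left (by omega)]
    exact h k x hk
  · cases hk

/-- A log that is possible with the proposals `c` is also possible when there are more. -/
theorem ValidLog.mono {c' : Fin n → Option VI} (hc : ∀ i v, c i = some v → c' i = some v)
    {L : Log n VO} (h : ValidLog A c L) : ValidLog A c' L := by
  intro k x hk
  have h1 := h k x hk
  unfold stepResult at h1 ⊢
  -- Only a start reads the proposals, and only that of the starting process.
  split at h1
  · split at h1
    · rename_i h2
      obtain ⟨v, hv, hv'⟩ := Option.map_eq_some_iff.1 h1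
      rw [if_pos h2, hc _ _ hv, Option.map_some, hv']
    · cases h1
  · exact h1
  · exact h1

/-- A process that has a state has started. -/
theorem ValidLog.start_mem {L : Log n VO} (h : ValidLog A c L) {i : Fin n}
    (hi : (stateOf L i).isSome) : ∃ x ∈ L, x.1 = (i, none) := by
  induction L using List.reverseRecOn with
  | nil => simp at hi
  | append_singleton l y ih =>
    have hl : ValidLog A c l := by simpa using h.take l.length
    by_cases hs : (stateOf l i).isSome
    · obtain ⟨x, hx, hx'⟩ := ih hl hs
      exact ⟨x, by simp [hx], hx'⟩
    · have hy : y.1.1 = i := by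
        by_contra hne
        rw [stateOf_concat, if_neg hne] at hi
        exact hs hi
      have h1 := h l.length y (by simp)
      rw [List.take_left'  rfl] at h1
      simp only [Bool.not_eq_true, Option.isSome_eq_false_iff, Option.isNone_iff_eq_none] at hs
      refine ⟨y, by simp, Prod.ext hy ?_⟩
      -- Ticks and receipts need an earlier state, so the step that first gives `i` a state is a
      -- start.
      unfold stepResult at h1
      split at h1
      · assumption
      · simp [hy, hs] at h1
      · simp [receiveResult, hy, hs] at h1

/-- A process with a proposal can start, unless it has started. -/
theorem stateOf_run_of_start_mem (L : Log n VO) {es : List (Event n)} {i : Fin n}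
    (hi : (i, none) ∈ es) (hc : (c i).isSome) : (stateOf (run A c L es) i).isSome := by
  obtain ⟨a, b, h, h' | ⟨r, b', rfl⟩⟩ := run_tries (A := A) (c := c) L hi
  · rw [h]
    apply stateOf_append_isSome
    by_contra hs
    simp only [Bool.not_eq_true, Option.isSome_eq_false_iff, Option.isNone_iff_eq_none] at hs
    simp only [stepResult, hs, if_true, Option.map_eq_none_iff] at h'
    simp [h'] at hc
  · rw [h]
    exact stateOf_isSome_of_mem (x := ((i, none), r)) (by simp)

/-- A process that has started can tick. -/
theorem tick_mem_run {L : Log n VO} {es : List (Event n)} {i : Fin n}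
    (hi : (i, some none) ∈ es) (hs : (stateOf L i).isSome) :
    ∃ k x, L.length ≤ k ∧ (run A c L es)[k]? = some x ∧ x.1 = (i, some none) := by
  obtain ⟨a, b, h, h' | ⟨r, b', rfl⟩⟩ := run_tries (A := A) (c := c) L hi
  · have := stateOf_append_isSome hs a
    simp only [stepResult, Option.map_eq_none_iff] at h'
    simp [h'] at this
  · refine ⟨(L ++ a).length, ((i, some none), r), by simp, ?_, rfl⟩
    rw [h]
    simp

/-- A process that has started can receive a message, unless it has received it. -/
theorem receive_mem_run {L : Log n VO} {es : List (Event n)} {i : Fin n} {k p m : ℕ}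
    {x : Event n × StepResult n VO} (hi : (i, some (some (k, p))) ∈ es)
    (hs : (stateOf L i).isSome) (hk : L[k]? = some x) (hp : x.2.2.1[p]? = some (i, m)) :
    ∃ y ∈ run A c L es, y.1 = (i, some (some (k, p))) := by
  obtain ⟨a, b, h, h' | ⟨r, b', rfl⟩⟩ := run_tries (A := A) (c := c) L hi
  · have h1 := stateOf_append_isSome hs a
    obtain ⟨s, hs'⟩ := Option.isSome_iff_exists.1 h1
    have hk' : (L ++ a)[k]? = some x := by
      rw [List.getElem?_append_left (List.getElem?_eq_some_iff.1 hk).1, hk]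
    -- The process still has a state and the message is still in the log, so an earlier receipt is
    -- the only possible obstacle.
    by_cases hmem : ∃ y ∈ L ++ a, y.1 = (i, some (some (k, p)))
    · obtain ⟨y, hy, hy'⟩ := hmem
      exact ⟨y, by rw [h]; exact List.mem_append_left _ hy, hy'⟩
    · simp only [stepResult, receiveResult, if_neg hmem, hs', hk', Option.bind_some, hp] at h'
      simp at h'
  · exact ⟨((i, some (some (k, p))), r), by rw [h]; simp, rfl⟩

end Run

/-! ### Computability of finite runs and the search for a decision -/

section RunComputable

variable {n : ℕ} {VI VO : Type*} [Primcodable VI] [Primcodable VO]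

theorem primrec_stateOf : Primrec fun x : Log n VO × Fin n => stateOf x.1 x.2 := by
  refine Primrec.list_foldl (h := fun (x : Log n VO × Fin n)
      (y : Option ℕ × (Event n × StepResult n VO)) =>
      if y.2.1.1 = x.2 then some y.2.2.1 else y.1) Primrec.fst (Primrec.const none) ?_
  refine Primrec.ite ?_ ?_ ?_
  · exact Primrec.eq.comp (Primrec.fst.comp (Primrec.fst.comp (Primrec.snd.comp Primrec.snd)))
      (Primrec.snd.comp Primrec.fst)
  · exact Primrec.option_some.comp
      (Primrec.fst.comp (Primrec.snd.comp (Primrec.snd.comp Primrec.snd)))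
  · exact Primrec.fst.comp Primrec.snd

theorem primrecPred_event_mem :
    PrimrecPred fun x : Log n VO × Event n => ∃ y ∈ x.1, y.1 = x.2 :=
  PrimrecRel.exists_mem_list (R := fun (y : Event n × StepResult n VO) (e : Event n) => y.1 = e)
    (Primrec.eq.comp (Primrec.fst.comp Primrec.fst) Primrec.snd)

theorem Computable.ite_primrecPred {α σ : Type*} [Primcodable α] [Primcodable σ] {p : α → Prop}
    [DecidablePred p] {f g : α → σ} (hp : PrimrecPred p) (hf : Computable f)
    (hg : Computable g) : Computable fun a => if p a then f a else g a :=
  (Computable.cond hp.decide.to_comp hf hg).of_eq fun a => by by_cases h : p a <;> simp [h]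

theorem Algorithm.computable_receive (A : Algorithm n VI VO) {α : Type*} [Primcodable α]
    {i j : α → Fin n} {s m : α → ℕ} (hi : Computable i) (hs : Computable s) (hj : Computable j)
    (hm : Computable m) : Computable fun a => A.receive (i a) (s a) (j a) (m a) :=
  A.receive_computable.comp (hi.pair (hs.pair (hj.pair hm)))

theorem primrecPred_event_mem_comp {α : Type*} [Primcodable α] {L : α → Log n VO}
    {e : α → Event n} (hL : Primrec L) (he : Primrec e) :
    PrimrecPred fun a => ∃ y ∈ L a, y.1 = e a :=
  primrecPred_event_mem.comp (hL.pair he)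

theorem computable_receiveResult (A : Algorithm n VI VO) :
    Computable fun x : (Log n VO × Fin n) × ℕ × ℕ => receiveResult A x.1.1 x.1.2 x.2 := by
  open Computable in
  have hs : Primrec fun x : (Log n VO × Fin n) × ℕ × ℕ => stateOf x.1.1 x.1.2 :=
    primrec_stateOf.comp Primrec.fst
  unfold receiveResult
  refine Computable.ite_primrecPred (primrecPred_event_mem_comp (Primrec.fst.comp Primrec.fst)
    ((Primrec.snd.comp Primrec.fst).pair
      (Primrec.option_some.comp (Primrec.option_some.comp Primrec.snd)))) (const none) ?_
  refine option_bind hs.to_comp ?_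
  refine option_bind (list_getElem?.comp (fst.comp (fst.comp fst)) (fst.comp (snd.comp fst))) ?_
  refine option_bind (list_getElem?.comp (fst.comp (snd.comp (snd.comp snd)))
    (snd.comp (snd.comp (fst.comp fst)))) ?_
  refine Computable.ite_primrecPred ?_ ?_ (const none)
  · exact Primrec.eq.comp (Primrec.fst.comp Primrec.snd) (Primrec.snd.comp (Primrec.fst.comp
      (Primrec.fst.comp (Primrec.fst.comp Primrec.fst))))
  · have h1 : Computable fun w : ((((Log n VO × Fin n) × ℕ × ℕ) × ℕ) ×
        Event n × StepResult n VO) × Fin n × ℕ => w.1.1.1.1.2 :=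
      snd.comp (fst.comp (fst.comp (fst.comp fst)))
    have h2 : Computable fun w : ((((Log n VO × Fin n) × ℕ × ℕ) × ℕ) ×
        Event n × StepResult n VO) × Fin n × ℕ => w.1.1.2 :=
      snd.comp (fst.comp fst)
    have h3 : Computable fun w : ((((Log n VO × Fin n) × ℕ × ℕ) × ℕ) ×
        Event n × StepResult n VO) × Fin n × ℕ => w.1.2.1.1 :=
      fst.comp (fst.comp (snd.comp fst))
    have h4 : Computable fun w : ((((Log n VO × Fin n) × ℕ × ℕ) × ℕ) ×
        Event n × StepResult n VO) × Fin n × ℕ => w.2.2 :=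
      snd.comp snd
    exact option_some.comp (A.computable_receive h1 h2 h3 h4)

theorem computable_stepResult (A : Algorithm n VI VO) :
    Computable fun x : (Fin n → Option VI) × Log n VO × Event n =>
      stepResult A x.1 x.2.1 x.2.2 := by
  open Computable in
  have hi : Computable fun x : (Fin n → Option VI) × Log n VO × Event n => x.2.2.1 :=
    fst.comp (snd.comp snd)
  have hs : Primrec fun x : (Fin n → Option VI) × Log n VO × Event n =>
      stateOf x.2.1 x.2.2.1 :=
    primrec_stateOf.comp (Primrec.pair (Primrec.fst.comp Primrec.snd)
      (Primrec.fst.comp (Primrec.snd.comp Primrec.snd)))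
  have hstart : Computable fun x : (Fin n → Option VI) × Log n VO × Event n =>
      if stateOf x.2.1 x.2.2.1 = none then (x.1 x.2.2.1).map (A.start x.2.2.1) else none := by
    refine Computable.ite_primrecPred (Primrec.eq.comp hs (Primrec.const none)) ?_ (const none)
    have h1 : Computable fun x : (Fin n → Option VI) × Log n VO × Event n => x.1 x.2.2.1 :=
      fin_app.comp fst hi
    have h2 : Computable fun y : ((Fin n → Option VI) × Log n VO × Event n) × VI =>
        A.start y.1.2.2.1 y.2 :=
      A.start_computable.comp (g := fun y : ((Fin n → Option VI) × Log n VO × Event n) × VI =>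
        (y.1.2.2.1, y.2)) (pair (hi.comp fst) snd)
    exact option_map h1 h2.to₂
  have htick : Computable fun x : (Fin n → Option VI) × Log n VO × Event n =>
      (stateOf x.2.1 x.2.2.1).map (A.tick x.2.2.1) := by
    have h2 : Computable fun y : ((Fin n → Option VI) × Log n VO × Event n) × ℕ =>
        A.tick y.1.2.2.1 y.2 :=
      A.tick_computable.comp (g := fun y : ((Fin n → Option VI) × Log n VO × Event n) × ℕ =>
        (y.1.2.2.1, y.2)) (pair (hi.comp fst) snd)
    exact option_map hs.to_comp h2.to₂
  have hreceive : Computable fun x : (((Fin n → Option VI) × Log n VO × Event n) ×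
      Option (ℕ × ℕ)) × ℕ × ℕ => receiveResult A x.1.1.2.1 x.1.1.2.2.1 x.2 :=
    (computable_receiveResult A).comp (g := fun x : (((Fin n → Option VI) × Log n VO × Event n) ×
      Option (ℕ × ℕ)) × ℕ × ℕ => ((x.1.1.2.1, x.1.1.2.2.1), x.2))
      (pair (pair (fst.comp (snd.comp (fst.comp fst))) (hi.comp (fst.comp fst))) snd)
  have htrigger : Computable fun x : (Fin n → Option VI) × Log n VO × Event n => x.2.2.2 :=
    snd.comp (snd.comp snd)
  have hsome : Computable fun y : ((Fin n → Option VI) × Log n VO × Event n) ×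
      Option (ℕ × ℕ) => (Option.casesOn y.2 ((stateOf y.1.2.1 y.1.2.2.1).map (A.tick y.1.2.2.1))
        fun q => receiveResult A y.1.2.1 y.1.2.2.1 q : Option (StepResult n VO)) :=
    option_casesOn snd (htick.comp fst) hreceive.to₂
  refine (option_casesOn htrigger hstart hsome.to₂).of_eq ?_
  rintro ⟨c, L, i, _ | _ | q⟩ <;> simp only [stepResult]

theorem computable_run (A : Algorithm n VI VO) :
    Computable fun x : (Fin n → Option VI) × List (Event n) => run A x.1 [] x.2 := by
  open Computable in
  have hext : Computable fun x : (Fin n → Option VI) × Log n VO × Event n =>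
      extendLog A x.1 x.2.1 x.2.2 := by
    refine (option_casesOn (computable_stepResult A) (fst.comp snd)
      (g := fun x r => x.2.1 ++ [(x.2.2, r)]) ?_).of_eq ?_
    · exact list_concat.comp (fst.comp (snd.comp fst)) (pair (snd.comp (snd.comp fst)) snd)
    · intro x
      unfold extendLog
      cases stepResult A x.1 x.2.1 x.2.2 <;> rfl
  -- `extendLog` is computable but need not be primitive recursive; the fold is expressed as a
  -- recursion on the number of events already processed.
  refine (nat_rec (f := fun x : (Fin n → Option VI) × List (Event n) => x.2.length)
    (g := fun _ => ([] : Log n VO)) (h := fun x y => Option.casesOn x.2[y.1]? y.2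
      fun e => extendLog A x.1 y.2 e) (list_length.comp snd) (const []) ?_).of_eq ?_
  · have h1 : Computable fun y : (((Fin n → Option VI) × List (Event n)) × ℕ × Log n VO) ×
        Event n => extendLog A y.1.1.1 y.1.2.2 y.2 :=
      hext.comp (g := fun y : (((Fin n → Option VI) × List (Event n)) × ℕ × Log n VO) ×
        Event n => (y.1.1.1, y.1.2.2, y.2))
        (pair (fst.comp (fst.comp fst)) (pair (snd.comp (snd.comp fst)) snd))
    have h2 : Computable fun y : ((Fin n → Option VI) × List (Event n)) × ℕ × Log n VO =>
        y.1.2[y.2.1]? :=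
      list_getElem?.comp (snd.comp fst) (fst.comp snd)
    exact (option_casesOn h2 (snd.comp snd) h1.to₂).to₂
  · rintro ⟨c, es⟩
    have h : ∀ k ≤ es.length, (Nat.rec ([] : Log n VO) (fun k L => Option.casesOn es[k]? L
        fun e => extendLog A c L e) k : Log n VO) = run A c [] (es.take k) := by
      intro k
      induction k with
      | zero => intro _; simp [run]
      | succ k ih =>
        intro hk
        have hk' : k < es.length := hk
        simp only [ih hk'.le, List.getElem?_eq_getElem hk', List.take_succ_eq_append_getElem hk',
          run_append]
        rfl
    simpa using h es.length le_rfl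

/-- In `L`, every process with a proposal decides `v`. -/
def AllDecide (c : Fin n → Option VI) (L : Log n VO) (v : VO) : Prop :=
  ∀ i, (c i).isSome → ∃ x ∈ L, x.1.1 = i ∧ x.2.2.2 = some v

theorem primrecPred_allDecide :
    PrimrecPred fun x : (Fin n → Option VI) × Log n VO × VO => AllDecide x.1 x.2.1 x.2.2 := by
  have h1 : PrimrecRel fun (L : Log n VO) (y : VO × Fin n) =>
      ∃ x ∈ L, x.1.1 = y.2 ∧ x.2.2.2 = some y.1 := by
    refine PrimrecRel.exists_mem_list (R := fun (x : Event n × StepResult n VO)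
      (y : VO × Fin n) => x.1.1 = y.2 ∧ x.2.2.2 = some y.1) ?_
    exact (Primrec.eq.comp (Primrec.fst.comp (Primrec.fst.comp Primrec.fst))
      (Primrec.snd.comp Primrec.snd)).and (Primrec.eq.comp
      (Primrec.snd.comp (Primrec.snd.comp (Primrec.snd.comp Primrec.fst)))
      (Primrec.option_some.comp (Primrec.fst.comp Primrec.snd)))
  have h2 : PrimrecRel fun (i : Fin n) (x : (Fin n → Option VI) × Log n VO × VO) =>
      x.1 i = none ∨ ∃ y ∈ x.2.1, y.1.1 = i ∧ y.2.2.2 = some x.2.2 :=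
    (Primrec.eq.comp (Primrec.fin_app.comp (Primrec.fst.comp Primrec.snd) Primrec.fst)
      (Primrec.const none)).or (h1.comp (Primrec.fst.comp (Primrec.snd.comp Primrec.snd))
      (Primrec.pair (Primrec.snd.comp (Primrec.snd.comp Primrec.snd)) Primrec.fst))
  refine (h2.forall_mem_list.comp (Primrec.const (List.finRange n)) Primrec.id).of_eq ?_
  rintro ⟨c, L, v⟩
  simp only [List.mem_finRange, true_imp_iff, AllDecide, id]
  refine forall_congr' fun i => ?_
  cases c i <;> simp

open Classical in
/-- A computable search for a finite run in which all processes with a proposal decide. -/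
theorem exists_computable_decision (A : Algorithm n VI VO) {α : Type*} [Primcodable α]
    (f : α → Fin n → Option VI) (hf : Computable f)
    (h : ∀ a, ∃ es v, AllDecide (f a) (run A (f a) [] es) v) :
    ∃ Λ : α → VO, Computable Λ ∧ ∀ a, ∃ es, AllDecide (f a) (run A (f a) [] es) (Λ a) := by
  -- The number `k` codes a candidate run together with a candidate value; `F a k` returns the value
  -- if the run confirms it.
  let F : α → ℕ → Option VO := fun a k =>
    (Encodable.decode (α := List (Event n) × VO) k).bind fun y =>
      if AllDecide (f a) (run A (f a) [] y.1) y.2 then some y.2 else none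
  open Computable in
  have hF : Computable₂ F := by
    refine option_bind (Computable.decode.comp snd) ?_
    have h1 : Computable fun x : (α × ℕ) × List (Event n) × VO =>
        decide (AllDecide (f x.1.1) (run A (f x.1.1) [] x.2.1) x.2.2) :=
      (primrecPred_allDecide (n := n) (VI := VI) (VO := VO)).decide.to_comp.comp
        (pair (hf.comp (fst.comp fst)) (pair ((computable_run A).comp
          (pair (hf.comp (fst.comp fst)) (fst.comp snd))) (snd.comp snd)))
    refine (Computable.cond h1 (option_some.comp (snd.comp snd)) (const none)).of_eq fun x => ?_
    by_cases hx : AllDecide (f x.1.1) (run A (f x.1.1) [] x.2.1) x.2.2 <;> simp [hx]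
  have hdom : ∀ a, (Nat.rfindOpt (F a)).Dom := by
    intro a
    obtain ⟨es, v, hv⟩ := h a
    exact Nat.rfindOpt_dom.2 ⟨Encodable.encode (es, v), v, by simp [F, hv]⟩
  refine ⟨fun a => (Nat.rfindOpt (F a)).get (hdom a),
    (Partrec.rfindOpt hF).of_eq_tot fun a => Part.get_mem _, fun a => ?_⟩
  obtain ⟨k, hk⟩ := Nat.rfindOpt_spec (Part.get_mem (hdom a))
  simp only [F, Option.mem_def, Option.bind_eq_some_iff] at hk
  obtain ⟨⟨es, v⟩, -, hy⟩ := hk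
  split at hy
  · rename_i hv
    refine ⟨es, ?_⟩
    convert hv using 1
    exact (Option.some.inj hy).symm
  · cases hy

end RunComputable

/-! ### Fair infinite continuations of a finite log -/

/-- An increasing sequence of lists of unbounded length has a limit. -/
theorem exists_limit_of_prefix {α : Type*} {l : ℕ → List α}
    (hl : ∀ r s, r ≤ s → l r <+: l s) (hlen : ∀ k, ∃ r, k < (l r).length) :
    ∃ (x : ℕ → α) (R : ℕ → ℕ), (∀ r k, k < (l r).length ↔ R k ≤ r) ∧
      ∀ r k, k < (l r).length → (l r)[k]? = some (x k) := by
  classical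
  -- `R k` is the first stage whose list has an entry at position `k`.
  refine ⟨fun k => (l (Nat.find (hlen k)))[k]'(Nat.find_spec (hlen k)),
    fun k => Nat.find (hlen k), fun r k => ⟨fun h => Nat.find_min' _ h, fun h => ?_⟩,
    fun r k hk => ?_⟩
  · exact (Nat.find_spec (hlen k)).trans_le (hl _ _ h).length_le
  · obtain ⟨z, hz⟩ := hl _ _ (Nat.find_min' (hlen k) hk)
    rw [← hz, List.getElem?_append_left (Nat.find_spec (hlen k)), List.getElem?_eq_getElem]

section Extension

variable {n : ℕ} {VI VO : Type*}

/-- A bound on the number of messages sent in any step of the log. -/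
def maxSent (L : Log n VO) : ℕ :=
  (Finset.range L.length).sup fun k => L[k]?.elim 0 fun x => x.2.2.1.length

/-- The events tried in round `r` after `L`: each of the processes in `C` receives all messages
sent in `L`, and its clock ticks if `D ∣ r`. -/
def roundEvents (C : Finset (Fin n)) (D r : ℕ) (L : Log n VO) : Finset (Event n) :=
  -- This rectangle contains the positions of all messages; the impossible events in it have no
  -- effect. Being a `Finset`, it tries each event at most once per round.
  C ×ˢ ((Finset.range L.length ×ˢ Finset.range (maxSent L)).image (fun q => some (some q)) ∪
    if D ∣ r then {some none} else ∅)

theorem tick_mem_roundEvents {C : Finset (Fin n)} {D r : ℕ} {L : Log n VO} {i : Fin n} :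
    (i, some none) ∈ roundEvents C D r L ↔ i ∈ C ∧ D ∣ r := by
  unfold roundEvents
  split <;> simp [*]

theorem receive_mem_roundEvents {C : Finset (Fin n)} {D r : ℕ} {L : Log n VO} {i : Fin n}
    {k p : ℕ} {x : Event n × StepResult n VO} (hi : i ∈ C) (hk : L[k]? = some x)
    (hp : p < x.2.2.1.length) : (i, some (some (k, p))) ∈ roundEvents C D r L := by
  have hk' := (List.getElem?_eq_some_iff.1 hk).1
  have h : x.2.2.1.length ≤ maxSent L := by
    have := Finset.le_sup (f := fun k => L[k]?.elim 0 fun x => x.2.2.1.length)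
      (Finset.mem_range.2 hk')
    rwa [hk] at this
  simp only [roundEvents, Finset.mem_product, Finset.mem_union, Finset.mem_image,
    Finset.mem_range]
  exact ⟨hi, .inl ⟨(k, p), ⟨hk', hp.trans_le h⟩, rfl⟩⟩

variable [Primcodable VI] [Primcodable VO]

/-- The log after round `r`, when `L` has happened before. In round `0`, the processes in `C`
start. -/
noncomputable def roundLog (A : Algorithm n VI VO) (c : Fin n → Option VI) (C : Finset (Fin n))
    (D : ℕ) (L : Log n VO) : ℕ → Log n VO
  | 0 => run A c L (C.toList.map fun i => (i, none))
  | r + 1 => run A c (roundLog A c C D L r)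
      (roundEvents C D (r + 1) (roundLog A c C D L r)).toList

variable {A : Algorithm n VI VO} {c : Fin n → Option VI} {C : Finset (Fin n)} {D : ℕ}
  {L : Log n VO}

theorem roundLog_prefix {r s : ℕ} (h : r ≤ s) :
    roundLog A c C D L r <+: roundLog A c C D L s := by
  induction s, h using Nat.le_induction with
  | base => exact List.prefix_rfl
  | succ s _ ih =>
    obtain ⟨new, hnew, -⟩ := run_eq_append (A := A) (c := c) (roundLog A c C D L s)
      (roundEvents C D (s + 1) (roundLog A c C D L s)).toList
    exact ih.trans ⟨new, hnew.symm⟩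

theorem roundLog_eq_run (r : ℕ) : ∃ es, roundLog A c C D L r = run A c L es := by
  induction r with
  | zero => exact ⟨_, rfl⟩
  | succ r ih =>
    obtain ⟨es, hes⟩ := ih
    exact ⟨es ++ (roundEvents C D (r + 1) (roundLog A c C D L r)).toList,
      by rw [run_append, ← hes]; rfl⟩

theorem stateOf_roundLog (hC : ∀ i ∈ C, (c i).isSome) (r : ℕ) {i : Fin n} (hi : i ∈ C) :
    (stateOf (roundLog A c C D L r) i).isSome := by
  obtain ⟨z, hz⟩ := roundLog_prefix (A := A) (c := c) (C := C) (D := D) (L := L) r.zero_le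
  rw [← hz]
  exact stateOf_append_isSome (stateOf_run_of_start_mem _ (by simpa using hi) (hC i hi)) _

/-- A started process can always tick, so a round with ticks adds a step even if no message is
pending. -/
theorem roundLog_length_lt (hC : ∀ i ∈ C, (c i).isSome) (hne : C.Nonempty) {r : ℕ}
    (hr : D ∣ r + 1) :
    (roundLog A c C D L r).length < (roundLog A c C D L (r + 1)).length := by
  obtain ⟨i, hi⟩ := hne
  obtain ⟨k, x, hk, hx, -⟩ := tick_mem_run (A := A) (c := c) (i := i)
    (es := (roundEvents C D (r + 1) (roundLog A c C D L r)).toList)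
    (Finset.mem_toList.2 (tick_mem_roundEvents.2 ⟨hi, hr⟩)) (stateOf_roundLog hC r hi)
  exact hk.trans_lt (List.getElem?_eq_some_iff.1 hx).1

theorem exists_lt_roundLog_length (hC : ∀ i ∈ C, (c i).isSome) (hne : C.Nonempty) (hD : 0 < D)
    (k : ℕ) : ∃ r, k < (roundLog A c C D L r).length := by
  have h : ∀ k, ∃ r, k ≤ (roundLog A c C D L r).length := by
    intro k
    induction k with
    | zero => exact ⟨0, Nat.zero_le _⟩
    | succ k ih =>
      obtain ⟨r, hr⟩ := ih
      have h1 : r + 1 ≤ D * (r + 1) := Nat.le_mul_of_pos_left _ hD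
      have h2 : D * (r + 1) - 1 + 1 = D * (r + 1) := by omega
      -- The round `D * (r + 1)` has ticks and comes after round `r`; it is written as a successor
      -- to match `roundLog_length_lt`.
      refine ⟨D * (r + 1) - 1 + 1, ?_⟩
      have h3 := roundLog_length_lt (A := A) (L := L) (D := D) (r := D * (r + 1) - 1) hC hne
        (by rw [h2]; exact dvd_mul_right _ _)
      have h4 := (roundLog_prefix (A := A) (c := c) (C := C) (D := D) (L := L)
        (show r ≤ D * (r + 1) - 1 by omega)).length_le
      omega
  obtain ⟨r, hr⟩ := h (k + 1)
  exact ⟨r, hr⟩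

/-- A valid log is the beginning of an infinite fair sequence of steps `x k`, where `R k` is the
round of the `k`-th step. -/
theorem exists_fair_extension (hC : ∀ i ∈ C, (c i).isSome) (hne : C.Nonempty) (hD : 0 < D)
    (hL : ValidLog A c L) :
    ∃ (x : ℕ → Event n × StepResult n VO) (R : ℕ → ℕ),
      (∀ K, ∃ es, K ≤ (run A c L es).length ∧
        ∀ k < (run A c L es).length, (run A c L es)[k]? = some (x k)) ∧
      (∀ k, stepResult A c ((List.range k).map x) (x k).1 = some (x k).2) ∧
      Monotone R ∧ Filter.Tendsto R Filter.atTop Filter.atTop ∧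
      (∀ i ∈ C, ∃ k, (x k).1 = (i, none) ∧ R k = 0) ∧
      (∀ k p j m, j ∈ C → (x k).2.2.1[p]? = some (j, m) →
        ∃ k', (x k').1 = (j, some (some (k, p))) ∧ R k' ≤ R k + 1) ∧
      (∀ k i, (x k).1 = (i, some none) → 0 < R k → D ∣ R k) ∧
      ∀ i ∈ C, ∀ m, 0 < m → ∃! k, (x k).1 = (i, some none) ∧ R k = D * m := by
  obtain ⟨x, R, hR, hx⟩ := exists_limit_of_prefix (l := roundLog A c C D L)
    (fun r s h => roundLog_prefix h) (exists_lt_roundLog_length hC hne hD)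
  have hmono : Monotone R := fun k k' h => (hR _ _).1 (h.trans_lt ((hR _ _).2 le_rfl))
  have hnew : ∀ r, ∃ new, roundLog A c C D L (r + 1) = roundLog A c C D L r ++ new ∧
      (new.map Prod.fst).Sublist (roundEvents C D (r + 1) (roundLog A c C D L r)).toList :=
    fun r => run_eq_append _ _
  -- The steps with `R k = r + 1` are those that round `r + 1` appends.
  have hget : ∀ k r new, R k = r + 1 →
      roundLog A c C D L (r + 1) = roundLog A c C D L r ++ new →
      (roundLog A c C D L r).length ≤ k ∧
        new[k - (roundLog A c C D L r).length]? = some (x k) := by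
    intro k r new hk h
    have h1 : (roundLog A c C D L r).length ≤ k := by
      by_contra hlt
      have := (hR r k).1 (not_le.1 hlt)
      omega
    refine ⟨h1, ?_⟩
    rw [← List.getElem?_append_right h1, ← h]
    exact hx _ _ ((hR _ _).2 hk.le)
  have hmem : ∀ r z, z ∈ roundLog A c C D L r → ∃ k, x k = z ∧ R k ≤ r := by
    intro r z hz
    obtain ⟨k, hk⟩ := List.mem_iff_getElem?.1 hz
    have hlt := (List.getElem?_eq_some_iff.1 hk).1
    exact ⟨k, Option.some.inj ((hx r k hlt).symm.trans hk), (hR r k).1 hlt⟩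
  have hvalid : ∀ r, ValidLog A c (roundLog A c C D L r) := by
    intro r
    obtain ⟨es, hes⟩ := roundLog_eq_run (A := A) (c := c) (C := C) (D := D) (L := L) r
    rw [hes]
    exact hL.run es
  refine ⟨x, R, fun K => ?_, fun k => ?_, hmono, ?_, fun i hi => ?_, fun k p j m hj hp => ?_,
    fun k i hk hpos => ?_, fun i hi m hm => ?_⟩
  · obtain ⟨r, hr⟩ := exists_lt_roundLog_length (A := A) (L := L) hC hne hD K
    obtain ⟨es, hes⟩ := roundLog_eq_run (A := A) (c := c) (C := C) (D := D) (L := L) r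
    refine ⟨es, ?_⟩
    rw [← hes]
    exact ⟨hr.le, hx r⟩
  · have hk := (hR (R k) k).2 le_rfl
    have h := hvalid (R k) k (x k) (hx _ _ hk)
    rwa [show (roundLog A c C D L (R k)).take k = (List.range k).map x from ?_] at h
    apply List.ext_getElem?
    intro m
    by_cases hm : m < k
    · rw [List.getElem?_take_of_lt hm, hx _ _ (hm.trans hk)]
      simp [hm]
    · rw [List.getElem?_eq_none (by simp; omega), List.getElem?_eq_none (by simp; omega)]
  · refine Filter.tendsto_atTop.2 fun r => ?_
    filter_upwards [Filter.eventually_ge_atTop (roundLog A c C D L r).length] with k hk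
    by_contra h
    exact absurd ((hR r k).2 (not_le.1 h).le) (not_lt.2 hk)
  · obtain ⟨z, hz, hz'⟩ := (hvalid 0).start_mem (stateOf_roundLog hC 0 hi)
    obtain ⟨k, rfl, hk⟩ := hmem 0 z hz
    exact ⟨k, hz', Nat.le_zero.1 hk⟩
  · have hk := hx (R k) k ((hR _ _).2 le_rfl)
    obtain ⟨z, hz, hz'⟩ := receive_mem_run (A := A) (c := c) (i := j)
      (es := (roundEvents C D (R k + 1) (roundLog A c C D L (R k))).toList)
      (Finset.mem_toList.2 (receive_mem_roundEvents hj hk (List.getElem?_eq_some_iff.1 hp).1))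
      (stateOf_roundLog hC _ hj) hk hp
    obtain ⟨k', rfl, hk'⟩ := hmem (R k + 1) z hz
    exact ⟨k', hz', hk'⟩
  · obtain ⟨r, hr⟩ := Nat.exists_eq_succ_of_ne_zero hpos.ne'
    obtain ⟨new, h1, h2⟩ := hnew r
    have h3 := List.mem_of_getElem? (hget k r new hr h1).2
    have h4 := Finset.mem_toList.1 (h2.subset (List.mem_map_of_mem h3))
    rw [hk, tick_mem_roundEvents] at h4
    rw [hr]
    exact h4.2
  · obtain ⟨r, hr⟩ := Nat.exists_eq_succ_of_ne_zero (Nat.mul_pos hD hm).ne'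
    have hdvd : D ∣ r + 1 := ⟨m, hr.symm⟩
    obtain ⟨k, z, hk, hz, hz'⟩ := tick_mem_run (A := A) (c := c) (i := i)
      (es := (roundEvents C D (r + 1) (roundLog A c C D L r)).toList)
      (Finset.mem_toList.2 (tick_mem_roundEvents.2 ⟨hi, hdvd⟩)) (stateOf_roundLog hC r hi)
    have hlt := (List.getElem?_eq_some_iff.1 hz).1
    obtain rfl : x k = z := Option.some.inj ((hx (r + 1) k hlt).symm.trans hz)
    have hRk : R k = r + 1 := by
      refine le_antisymm ((hR _ _).1 hlt) (not_lt.1 fun h => ?_)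
      exact absurd ((hR r k).2 (Nat.lt_succ_iff.1 h)) (not_lt.2 hk)
    refine ⟨k, ⟨hz', hRk.trans hr.symm⟩, fun l ⟨hl, hRl⟩ => ?_⟩
    obtain ⟨new, h1, h2⟩ := hnew r
    obtain ⟨hk1, hk2⟩ := hget k r new hRk h1
    obtain ⟨hl1, hl2⟩ := hget l r new (hRl.trans hr) h1
    -- No event occurs twice in one round, so the tick of `i` has a single position there.
    have hnd : (new.map Prod.fst).Nodup := h2.nodup (Finset.nodup_toList _)
    have := (List.getElem?_inj (i := k - (roundLog A c C D L r).length)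
      (j := l - (roundLog A c C D L r).length)
      (by simpa using (List.getElem?_eq_some_iff.1 hk2).1) hnd).1
      (by rw [List.getElem?_map, List.getElem?_map, hk2, hl2]; simp [hz', hl])
    omega

end Extension

/-! ### From fair sequences of steps to executions -/

section Extension

variable {n : ℕ} {VI VO : Type*}

/-- The trigger of a step, given the event and the proposals. -/
def triggerOf (c : Fin n → Option VI) (e : Event n) : Trigger VI :=
  match e.2 with
  | none => (c e.1).elim .tick .start
  | some none => .tick
  | some (some q) => .receive q.1 q.2

theorem event_eq_of_triggerOf_eq_receive {e : Event n} {k p : ℕ}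
    (h : triggerOf c e = .receive k p) : e.2 = some (some (k, p)) := by
  obtain ⟨i, _ | _ | q⟩ := e
  · cases hc : c i <;> simp [triggerOf, hc] at h
  · simp [triggerOf] at h
  · simp only [triggerOf, Trigger.receive.injEq] at h
    simp [← h.1, ← h.2]

variable [Primcodable VI] [Primcodable VO]
  {A : Algorithm n VI VO} {c : Fin n → Option VI} {C : Finset (Fin n)} {L : Log n VO}

/-- `triggerOf` takes the default value `.tick` at the start of a process without proposal; `hr`
excludes this, as such a start is impossible. -/
theorem event_eq_of_triggerOf_eq_tick {e : Event n} {r : StepResult n VO}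
    (hr : stepResult A c L e = some r) (h : triggerOf c e = .tick) : e.2 = some none := by
  obtain ⟨i, _ | _ | q⟩ := e
  · cases hc : c i <;> simp_all [triggerOf, stepResult]
  · rfl
  · simp [triggerOf] at h

theorem receiveResult_eq_some {i : Fin n} {q : ℕ × ℕ} {r : StepResult n VO}
    (h : receiveResult A L i q = some r) :
    (∀ y ∈ L, y.1 ≠ (i, some (some q))) ∧ ∃ s x m, stateOf L i = some s ∧
      L[q.1]? = some x ∧ x.2.2.1[q.2]? = some (i, m) ∧ r = A.receive i s x.1.1 m := by
  unfold receiveResult at h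
  split at h
  · cases h
  · rename_i hmem
    simp only [Option.bind_eq_some_iff] at h
    obtain ⟨s, hs, x, hx, ⟨j, m⟩, hy, h⟩ := h
    split at h
    · rename_i hj
      subst hj
      exact ⟨fun y hy hy' => hmem ⟨y, hy, hy'⟩, s, x, m, hs, hx, hy, (Option.some.inj h).symm⟩
    · cases h

/-- A valid log is the beginning of an execution in which `C` are the correct processes: the
steps of the log happen at time `0`, before GST. -/
theorem exists_execution_of_validLog {t : ℕ} {δ : ℝ} (hδ : 0 < δ)
    (hC : ∀ i ∈ C, (c i).isSome) (hne : C.Nonempty) (hcard : n - t ≤ C.card)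
    (hL : ValidLog A c L) :
    ∃ E : Execution A t δ, E.corr = C ∧ (∀ i ∈ C, ∀ v, c i = some v → E.Proposes i v) ∧
      ∀ K, ∃ es, K ≤ (run A c L es).length ∧ ∀ k x, (run A c L es)[k]? = some x →
        E.actor k = x.1.1 ∧ E.decision k = x.2.2.2 := by
  -- With `D = N + 1` rounds per unit of time, a round lasts at most `δ`.
  obtain ⟨N, hN⟩ := exists_nat_one_div_lt hδ
  have hD : (0 : ℝ) < (N + 1 : ℕ) := by positivity
  generalize hDN : N + 1 = D at hD
  have hDδ : 1 / (D : ℝ) ≤ δ := by rw [← hDN]; push_cast; exact hN.le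
  obtain ⟨x, R, hrun, hstep, hmono, htend, hstart, hdel, htick, htick'⟩ :=
    exists_fair_extension (D := D) hC hne (by exact_mod_cast hD) hL
  have hget : ∀ {k k' : ℕ} {y : Event n × StepResult n VO},
      ((List.range k).map x)[k']? = some y → k' < k ∧ x k' = y := by
    intro k k' y h
    have hlt : k' < k := by simpa using (List.getElem?_eq_some_iff.1 h).1
    refine ⟨hlt, ?_⟩
    simpa [hlt] using h
  have htrig : ∀ {k : ℕ} {i : Fin n}, (x k).1.1 = i → triggerOf c (x k).1 = .tick →
      (x k).1 = (i, some none) := fun {k i} hi h =>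
    Prod.ext hi (event_eq_of_triggerOf_eq_tick (hstep k) h)
  have htime : ∀ k m : ℕ, ((R k : ℝ) / D = 2 + m) ↔ R k = D * (m + 2) := by
    intro k m
    rw [div_eq_iff hD.ne']
    constructor
    · intro h
      have : (R k : ℝ) = (D * (m + 2) : ℕ) := by rw [h]; push_cast; ring
      exact_mod_cast this
    · intro h
      rw [h]
      push_cast
      ring
  -- Round `r` takes place at time `r / D`. The log `L` belongs to round 0, so its ticks precede GST
  -- and are unconstrained. Processes outside `C` act only within `L`.
  let E : Execution A t δ :=
    { corr := C
      GST := 1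
      time := fun k => R k / D
      actor := fun k => (x k).1.1
      trigger := fun k => triggerOf c (x k).1
      sent := fun k => (x k).2.2.1
      decision := fun k => (x k).2.2.2
      state := fun k i => stateOf ((List.range k).map x) i
      corr_card := hcard
      GST_nonneg := zero_le_one
      time_nonneg := fun k => by positivity
      time_mono := fun k l h => by
        have := hmono h
        dsimp only
        gcongr
      time_tendsto := (tendsto_natCast_atTop_atTop.comp htend).atTop_div_const hD
      state_zero := fun i _ => rfl
      state_of_ne := fun k i _ h => by
        simp only [List.range_succ, List.map_append, List.map_cons, List.map_nil,
          stateOf_concat, if_neg h.symm]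
      step := fun k _ => by
        refine ⟨(x k).2, ?_, by simp [List.range_succ], rfl, rfl⟩
        have h := hstep k
        generalize hy : x k = y at h
        obtain ⟨⟨i, _ | _ | q⟩, r⟩ := y
        · simp only [stepResult] at h
          split at h
          · rename_i h1
            obtain ⟨v, hv, hv'⟩ := Option.map_eq_some_iff.1 h
            simp only [triggerOf, hv, Option.elim]
            exact ⟨h1, hv'.symm⟩
          · cases h
        · simp only [stepResult] at h
          obtain ⟨s, hs, hs'⟩ := Option.map_eq_some_iff.1 h
          simp only [triggerOf]
          exact ⟨s, hs, hs'.symm⟩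
        · simp only [stepResult] at h
          obtain ⟨-, s, z, m, hs, hz, hp, hr⟩ := receiveResult_eq_some h
          obtain ⟨hlt, rfl⟩ := hget hz
          simp only [triggerOf]
          exact ⟨s, m, hs, hlt, hp, hr⟩
      receive_once := by
        -- The message determines its recipient, so the two steps would be the same event, and
        -- `receiveResult` rejects an event already in the log.
        have key : ∀ k₁ k₂ k p, triggerOf c (x k₁).1 = .receive k p →
            triggerOf c (x k₂).1 = .receive k p → ¬ k₁ < k₂ := by
          intro k₁ k₂ k p h1 h2 hlt
          have h1' := event_eq_of_triggerOf_eq_receive h1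
          have h2' := event_eq_of_triggerOf_eq_receive h2
          have hr : ∀ l, (x l).1.2 = some (some (k, p)) →
              receiveResult A ((List.range l).map x) (x l).1.1 (k, p) = some (x l).2 := by
            intro l hl
            have := hstep l
            simpa only [stepResult, hl] using this
          obtain ⟨-, -, z₁, m₁, -, hz₁, hp₁, -⟩ := receiveResult_eq_some (hr k₁ h1')
          obtain ⟨hn, -, z₂, m₂, -, hz₂, hp₂, -⟩ := receiveResult_eq_some (hr k₂ h2')
          obtain ⟨-, rfl⟩ := hget hz₁
          obtain ⟨-, rfl⟩ := hget hz₂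
          have h3 := hp₁.symm.trans hp₂
          simp only [Option.some.injEq, Prod.mk.injEq] at h3
          exact hn (x k₁) (List.mem_map_of_mem (List.mem_range.2 hlt)) (Prod.ext h3.1 h1')
        intro k₁ k₂ k p _ _ h1 h2
        exact le_antisymm (not_lt.1 (key k₂ k₁ k p h2 h1)) (not_lt.1 (key k₁ k₂ k p h1 h2))
      delivery := fun k p j m _ hj hp => by
        obtain ⟨k', hk', hR⟩ := hdel k p j m hj hp
        refine ⟨k', by rw [hk'], by rw [hk']; rfl, ?_⟩
        have h1 : (R k' : ℝ) ≤ R k + 1 := by exact_mod_cast hR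
        calc (R k' : ℝ) / D ≤ (R k + 1) / D := by gcongr
          _ = R k / D + 1 / D := add_div _ _ _
          _ ≤ max ((R k : ℝ) / D) 1 + δ := add_le_add (le_max_left _ _) hDδ
      start_le := fun i hi => by
        obtain ⟨k, hk, hR⟩ := hstart i hi
        obtain ⟨v, hv⟩ := Option.isSome_iff_exists.1 (hC i hi)
        exact ⟨k, v, by rw [hk], by simp [hk, triggerOf, hv], by simp [hR]⟩
      clock := fun i hi => by
        -- After round 0, ticks occur in the rounds divisible by `D`, hence at integer times; the
        -- first one strictly after GST is at time 2.
        refine ⟨2, by norm_num, by norm_num, fun k hk hk' hlt => ?_, fun m => ?_⟩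
        · have h1 : 0 < R k := by
            by_contra h0
            rw [Nat.eq_zero_of_not_pos h0] at hlt
            norm_num at hlt
          obtain ⟨q, hq⟩ := htick k i (htrig hk hk') h1
          have hq2 : 2 ≤ q := by
            by_contra h
            have hq' : (q : ℝ) ≤ 1 := by exact_mod_cast Nat.lt_succ_iff.1 (not_le.1 h)
            rw [hq, Nat.cast_mul, mul_div_cancel_left₀ _ hD.ne'] at hlt
            exact hq'.not_gt hlt
          exact ⟨q - 2, (htime k _).2 (by rw [hq, Nat.sub_add_cancel hq2])⟩
        · obtain ⟨k, ⟨hk, hR⟩, huniq⟩ := htick' i hi (m + 2) (by omega)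
          refine ⟨k, ⟨by rw [hk], by rw [hk]; rfl, (htime k m).2 hR⟩, ?_⟩
          rintro l ⟨hl, hl', hl''⟩
          exact huniq l ⟨htrig hl hl', (htime l m).1 hl''⟩ }
  refine ⟨E, rfl, fun i hi v hv => ⟨hi, ?_⟩, fun K => ?_⟩
  · obtain ⟨k, hk, -⟩ := hstart i hi
    exact ⟨k, by simp [E, hk], by simp [E, hk, triggerOf, hv]⟩
  · obtain ⟨es, hK, hes⟩ := hrun K
    refine ⟨es, hK, fun k y hy => ?_⟩
    have h := (hes k (List.getElem?_eq_some_iff.1 hy).1).symm.trans hy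
    rw [← Option.some.inj h]
    exact ⟨rfl, rfl⟩

end Extension

/-! ### Decided values are admissible for similar configurations -/

section Main

variable {n t : ℕ} {VI VO : Type*}

theorem mem_procs {c : Fin n → Option VI} {i : Fin n} : i ∈ procs c ↔ (c i).isSome := by
  simp [procs]

variable [Primcodable VI] [Primcodable VO] {A : Algorithm n VI VO} {δ : ℝ}
  {val : ValidityProperty n t VI VO}

/-- Some finite run without steps of other processes lets all processes of `c` decide. -/
theorem exists_allDecide (hδ : 0 < δ) (htn : t < n) (hA : Solves A δ val)
    (c : InputConfig n t VI) : ∃ es v, AllDecide c.1 (run A c.1 [] es) v := by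
  have hne : (procs c.1).Nonempty :=
    Finset.card_pos.1 ((Nat.sub_pos_of_lt htn).trans_le c.2)
  obtain ⟨E, hcorr, -, hrun⟩ := exists_execution_of_validLog (A := A) (t := t) hδ
    (fun i hi => mem_procs.1 hi) hne c.2 validLog_nil
  have hterm : ∀ i, ∃ k, i ∈ procs c.1 → ∃ v, E.DecidesAt i v k := by
    intro i
    by_cases hi : i ∈ procs c.1
    · obtain ⟨v, k, h⟩ := hA.termination E i (hcorr ▸ hi)
      exact ⟨k, fun _ => ⟨v, h⟩⟩
    · exact ⟨0, fun h => absurd h hi⟩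
  choose k hk using hterm
  obtain ⟨i₀, hi₀⟩ := hne
  obtain ⟨v, hv⟩ := hk i₀ hi₀
  -- The finite run is taken long enough to contain a deciding step of every process of `c`.
  obtain ⟨es, hK, hes⟩ := hrun (Finset.univ.sup k + 1)
  refine ⟨es, v, fun i hi => ?_⟩
  obtain ⟨w, hw⟩ := hk i (mem_procs.2 hi)
  obtain rfl : w = v := hA.agreement E _ _ _ _ _ _ hw hv
  have hlt : k i < (run A c.1 [] es).length :=
    (Nat.lt_succ_of_le (Finset.le_sup (Finset.mem_univ i))).trans_le hK
  obtain ⟨h1, h2⟩ := hes (k i) _ (List.getElem?_eq_getElem hlt)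
  exact ⟨_, List.getElem_mem hlt, h1.symm.trans hw.2.1, h2.symm.trans hw.2.2⟩

/-- A value decided by all processes of `c` in a finite run without steps of other processes is
admissible for every configuration similar to `c`: the processes of `c` that are not in the
similar configuration can be faulty, and the other ones can be slow. -/
theorem mem_adm_of_allDecide (hδ : 0 < δ) (hA : Solves A δ val) {c c' : InputConfig n t VI}
    (hsim : SimilarConfig c' c) {es : List (Event n)} {v : VO}
    (hv : AllDecide c.1 (run A c.1 [] es) v) : v ∈ val.adm c' := by
  obtain ⟨⟨i, hi⟩, hagree⟩ := hsim
  rw [Finset.mem_inter] at hi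
  -- The merged proposals extend `c`, so the run stays valid, and also extend `c'`, because
  -- similarity makes the two agree wherever both are defined.
  let d : Fin n → Option VI := fun j => c.1 j <|> c'.1 j
  have hd : ∀ j v, c.1 j = some v → d j = some v := fun j v h => by simp [d, h]
  have hd' : ∀ j v, c'.1 j = some v → d j = some v := by
    intro j v h
    cases hj : c.1 j with
    | none => simp [d, hj, h]
    | some w =>
      have := hagree j (Finset.mem_inter.2 ⟨mem_procs.2 (by simp [h]), mem_procs.2 (by simp [hj])⟩)
      simp [d, ← this, h]
  obtain ⟨E, hcorr, hprop, hrun⟩ := exists_execution_of_validLog (A := A) (t := t) hδ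
    (c := d) (C := procs c'.1) (L := run A c.1 [] es) (fun j hj => by
      obtain ⟨w, hw⟩ := Option.isSome_iff_exists.1 (mem_procs.1 hj)
      simp [hd' j w hw]) ⟨i, hi.1⟩ c'.2 ((validLog_nil.run es).mono hd)
  -- No length is required: every run continuing the given log already contains the decision of `i`.
  obtain ⟨es', -, hes'⟩ := hrun 0
  obtain ⟨x, hx, hxi, hxv⟩ := hv i (mem_procs.1 hi.2)
  obtain ⟨new, hnew, -⟩ := run_eq_append (A := A) (c := d) (run A c.1 [] es) es'
  obtain ⟨k, hk⟩ := List.mem_iff_getElem?.1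
    (show x ∈ run A d (run A c.1 [] es) es' by rw [hnew]; exact List.mem_append_left _ hx)
  obtain ⟨h1, h2⟩ := hes' k x hk
  refine hA.validity E c' ⟨hcorr.symm, fun j w hw => ?_⟩ i v k
    ⟨hcorr ▸ hi.1, h1.trans hxi, h2.trans hxv⟩
  exact hprop j (mem_procs.2 (by simp [hw])) w (hd' j w hw)

end Main

theorem theorem3 {VI VO : Type*} [Primcodable VI] [Primcodable VO] (n t : ℕ) (ht : 0 < t)
    (htn : t < n) (δ : ℝ) (hδ : 0 < δ) (val : ValidityProperty n t VI VO)
    (hval : Solvable δ val) : SimilarityCondition val := by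
  obtain ⟨A, hA⟩ := hval
  have hval : Primrec fun c : InputConfigOfSize n t VI (n - t) => c.1 :=
    Primrec.subtype_val (hp := Primrec.eq.comp
      ((primrec_card_procs n VI).comp (primrec_inputConfig_val n t VI)) (Primrec.const (n - t)))
  have hf : Computable fun c : InputConfigOfSize n t VI (n - t) => c.1.1 :=
    ((primrec_inputConfig_val n t VI).comp hval).to_comp
  obtain ⟨Λ, hΛ, h⟩ := exists_computable_decision A _ hf fun c =>
    exists_allDecide hδ htn hA c.1
  refine ⟨Λ, hΛ, fun c c' hsim => ?_⟩
  obtain ⟨es, hes⟩ := h c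
  exact mem_adm_of_allDecide hδ hA hsim hes
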